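/- Let $(X,\mathfrak B,\mu)$ be a $\sigma$-finite non-atomic standard measure space, and let $\mathrm{Aut}(X,\mu)$ be the group of $\mu$-nonsingular invertible transformations of $X$ (identified when they agree $\mu$-a.e.). For $T\in\mathrm{Aut}(X,\mu)$ let $\mu\circ T$ be the measure $A\mapsto\mu(TA)$. Let $$\mathrm{Aut}_1(X,\mu)=\Big\{T\in\mathrm{Aut}(X,\mu) : \tfrac{d\mu\circ T}{d\mu}-1\in L^1(X,\mu)\Big\},\qquad \chi(T)=\int_X\Big(\tfrac{d\mu\circ T}{d\mu}-1\Big)\,d\mu .$$ Let $X^*$ be the space of counting measures on $X$ (countable sums of Dirac measures) with the $\sigma$-algebra generated by the maps $\omega\mapsto\omega(B)$, $B\in\mathfrak B$; let $\mu^*$ be the law on $X^*$ of the Poisson point process of intensity $\mu$; and for $T\in\mathrm{Aut}(X,\mu)$ let $T_*\omega=\omega\circ T^{-1}$, $\omega\in X^*$. A countable subgroup $\Lambda\subset\mathrm{Aut}(Y,\nu)$ is called conservative if for each measurable $B\subset Y$ with $\nu(B)>0$ and $\nu$-a.e. $y\in B$ there are infinitely many $\lambda\in\Lambda$ with $\lambda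 y\in B$. **Lemma.** Let $\Gamma$ be a countable subgroup of $\mathrm{Aut}_1(X,\mu)$ such that $\chi(\gamma)=0$ and $\big(\frac{d\mu}{d\mu\circ\gamma}\big)^2-1\in L^1(X,\mu)$ for each $\gamma\in\Gamma$. Suppose that there are positive reals $(b_\gamma)_{\gamma\in\Gamma}$ with $$\sum_{\gamma\in\Gamma}b_\gamma=\infty\qquad\text{and}\qquad \sum_{\gamma\in\Gamma}b_\gamma^2\exp\Big(\int_X\Big(\Big(\tfrac{d\mu}{d\mu\circ\gamma}\Big)^2-1\Big)d\mu\Big)<\infty .$$ Then $\gamma_*\in\mathrm{Aut}(X^*,\mu^*)$ for each $\gamma\in\Gamma$, the map $\gamma\mapsto\gamma_*$ is a homomorphism, and the Poisson suspension $\Gamma_*=\{\gamma_*:\gamma\in\Gamma\}$ is a conservative subgroup of $\mathrm{Aut}(X^*,\mu^*)$. -/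

import Mathlib

open MeasureTheory

noncomputable section

namespace PoissonSuspension

/-! ### Nonsingular transformations modulo null sets -/

/-- Invertible bimeasurable maps `T : X → X` such that `T` and `T⁻¹` pull null sets back to
null sets. -/
def nonsingularPerm {X : Type*} [MeasurableSpace X] (μ : Measure X) :
    Subgroup (Equiv.Perm X) where
  carrier := {T | Measure.QuasiMeasurePreserving T μ μ ∧
    Measure.QuasiMeasurePreserving T.symm μ μ}
  one_mem' := ⟨.id μ, .id μ⟩
  mul_mem' := fun hS hT => ⟨hS.1.comp hT.1, hT.2.comp hS.2⟩
  inv_mem' := fun hT => ⟨hT.2, hT.1⟩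

/-- The nonsingular transformations that are the identity almost everywhere. -/
def aeTrivial {X : Type*} [MeasurableSpace X] (μ : Measure X) :
    Subgroup (nonsingularPerm μ) where
  carrier := {T | ∀ᵐ x ∂μ, (T : Equiv.Perm X) x = x}
  one_mem' := by
    change ∀ᵐ x ∂μ, x = x
    exact Filter.Eventually.of_forall fun _ => rfl
  mul_mem' := by
    intro S T hS hT
    change ∀ᵐ x ∂μ, (S : Equiv.Perm X) ((T : Equiv.Perm X) x) = x
    filter_upwards [T.2.1.ae hS, hT] with x h1 h2
    rw [h1, h2]
  inv_mem' := by
    intro T hT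
    change ∀ᵐ x ∂μ, (T : Equiv.Perm X).symm x = x
    filter_upwards [T.2.2.ae hT] with x h
    rw [Equiv.apply_symm_apply] at h
    exact h.symm

instance {X : Type*} [MeasurableSpace X] (μ : Measure X) : (aeTrivial μ).Normal where
  conj_mem := by
    intro T hT S
    change ∀ᵐ x ∂μ,
      (S : Equiv.Perm X) ((T : Equiv.Perm X) ((S : Equiv.Perm X).symm x)) = x
    filter_upwards [S.2.2.ae hT] with x h
    rw [h, Equiv.apply_symm_apply]

/-- `Aut(X, μ)`: the group of nonsingular invertible transformations, two of them being identified
if they agree almost everywhere. -/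
abbrev Aut {X : Type*} [MeasurableSpace X] (μ : Measure X) : Type _ :=
  nonsingularPerm μ ⧸ aeTrivial μ

/-- A map representing an element of `Aut(X, μ)` (well defined up to a null set). -/
def Aut.rep {X : Type*} [MeasurableSpace X] {μ : Measure X} (T : Aut μ) : Equiv.Perm X :=
  (Quotient.out T : nonsingularPerm μ)

/-- The measure `μ ∘ T : A ↦ μ (T A)`, that is, the image of `μ` under `T⁻¹`. -/
def compAut {X : Type*} [MeasurableSpace X] (μ : Measure X) (T : Aut μ) : Measure X :=
  μ.map T.rep.symm

/-- `Aut₁(X, μ)`: those `T` for which `d(μ ∘ T)/dμ - 1` is `μ`-integrable. -/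
def Aut₁ {X : Type*} [MeasurableSpace X] (μ : Measure X) : Set (Aut μ) :=
  {T | Integrable (fun x => ((compAut μ T).rnDeriv μ x).toReal - 1) μ}

/-- `χ(T) = ∫ (d(μ ∘ T)/dμ - 1) dμ`. -/
def χ {X : Type*} [MeasurableSpace X] (μ : Measure X) (T : Aut μ) : ℝ :=
  ∫ x, (((compAut μ T).rnDeriv μ x).toReal - 1) ∂μ

/-- A (countable) subgroup `Γ` of `Aut(X, μ)` is conservative if, for every measurable `B` of
positive measure, almost every point of `B` returns to `B` under infinitely many elements
of `Γ`. -/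
def IsConservative {X : Type*} [MeasurableSpace X] {μ : Measure X} (Γ : Subgroup (Aut μ)) :
    Prop :=
  ∀ B : Set X, MeasurableSet B → 0 < μ B →
    ∀ᵐ x ∂μ, x ∈ B → {γ : Aut μ | γ ∈ Γ ∧ γ.rep x ∈ B}.Infinite

/-! ### The space of configurations and the Poisson measure -/

/-- `X*`: the counting measures on `X`, that is, the sums of countably many Dirac measures. -/
def Configuration (X : Type*) [MeasurableSpace X] : Type _ :=
  {ω : Measure X // ∃ (ι : Type) (_ : Countable ι) (x : ι → X),
    ω = Measure.sum fun i => Measure.dirac (x i)}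

/-- The σ-algebra on `X*` generated by the maps `ω ↦ ω(B)`, `B` measurable. -/
instance (X : Type*) [MeasurableSpace X] : MeasurableSpace (Configuration X) :=
  inferInstanceAs (MeasurableSpace {ω : Measure X // ∃ (ι : Type) (_ : Countable ι) (x : ι → X),
    ω = Measure.sum fun i => Measure.dirac (x i)})

/-- The configuration `δ_{x 0} + ⋯ + δ_{x (n - 1)}`. -/
def Configuration.ofPoints {X : Type*} [MeasurableSpace X] (n : ℕ) (x : Fin n → X) :
    Configuration X :=
  ⟨Measure.sum fun i => Measure.dirac (x i), Fin n, inferInstance, x, rfl⟩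

/-- The superposition of countably many configurations. -/
def Configuration.superpose {X : Type*} [MeasurableSpace X] (ω : ℕ → Configuration X) :
    Configuration X :=
  ⟨Measure.sum fun k => (ω k).1, by
    choose ι hι x hx using fun k => (ω k).2
    refine ⟨Σ k, ι k, inferInstance, fun p => x p.1 p.2, ?_⟩
    ext s hs
    simp_rw [hx]
    rw [Measure.sum_apply _ hs, Measure.sum_apply _ hs, ENNReal.tsum_sigma']
    exact tsum_congr fun k => Measure.sum_apply _ hs⟩

/-- The map `T_* : X* → X*` that sends a configuration to its image under a measurable map
`T`. -/
def Configuration.map {X : Type*} [MeasurableSpace X] (T : X → X) (hT : Measurable T)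
    (ω : Configuration X) : Configuration X :=
  ⟨ω.1.map T, by
    obtain ⟨ι, hι, x, hx⟩ := ω.2
    refine ⟨ι, hι, fun i => T (x i), ?_⟩
    rw [hx, Measure.map_sum hT.aemeasurable]
    simp_rw [Measure.map_dirac' hT]⟩

theorem measurable_ofPoints {X : Type*} [MeasurableSpace X] (n : ℕ) :
    Measurable (Configuration.ofPoints (X := X) n) := by
  refine Measurable.subtype_mk (Measure.measurable_of_measurable_coe _ fun s hs => ?_)
  simp_rw [Measure.sum_apply _ hs]
  exact Measurable.tsum fun i =>
    (Measure.measurable_coe hs).comp (Measure.measurable_dirac.comp (measurable_pi_apply i))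

theorem measurable_superpose {X : Type*} [MeasurableSpace X] :
    Measurable (Configuration.superpose (X := X)) := by
  refine Measurable.subtype_mk (Measure.measurable_of_measurable_coe _ fun s hs => ?_)
  simp_rw [Measure.sum_apply _ hs]
  exact Measurable.tsum fun k =>
    (Measure.measurable_coe hs).comp (measurable_subtype_coe.comp (measurable_pi_apply k))

/-- The law of the Poisson point process whose intensity is a finite measure `ν`:
`∑ n, e^{-ν(X)} / n! • (law of δ_{x 0} + ⋯ + δ_{x (n - 1)} under ν^n)`. -/
def finitePoisson {X : Type*} [MeasurableSpace X] (ν : Measure X) [IsFiniteMeasure ν] :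
    Measure (Configuration X) :=
  Measure.sum fun n : ℕ =>
    ENNReal.ofReal (Real.exp (-(ν.real Set.univ)) / n.factorial) •
      (Measure.pi fun _ : Fin n => ν).map (Configuration.ofPoints n)

instance {X : Type*} [MeasurableSpace X] (ν : Measure X) [IsFiniteMeasure ν] :
    IsProbabilityMeasure (finitePoisson ν) := by
  constructor
  have h : ∀ n : ℕ, (ENNReal.ofReal (Real.exp (-(ν.real Set.univ)) / n.factorial) •
      (Measure.pi fun _ : Fin n => ν).map (Configuration.ofPoints n)) Set.univ =
      ENNReal.ofReal (Real.exp (-(ν.real Set.univ)) *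
        ((ν.real Set.univ) ^ n / n.factorial)) := by
    intro n
    rw [Measure.smul_apply, Measure.map_apply (measurable_ofPoints n) MeasurableSet.univ,
      Set.preimage_univ, Measure.pi_univ, Finset.prod_const, Finset.card_univ, Fintype.card_fin,
      smul_eq_mul, ← ofReal_measureReal (μ := ν) (s := Set.univ),
      ← ENNReal.ofReal_pow measureReal_nonneg, ← ENNReal.ofReal_mul (by positivity)]
    congr 1
    ring
  have hs : HasSum (fun n : ℕ => Real.exp (-(ν.real Set.univ)) *
      ((ν.real Set.univ) ^ n / n.factorial)) 1 := by
    have h1 := (NormedSpace.expSeries_div_hasSum_exp (ν.real Set.univ)).mul_left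
      (Real.exp (-(ν.real Set.univ)))
    rwa [← Real.exp_eq_exp_ℝ, ← Real.exp_add, neg_add_cancel, Real.exp_zero] at h1
  rw [finitePoisson, Measure.sum_apply _ MeasurableSet.univ]
  simp_rw [h]
  rw [← ENNReal.ofReal_tsum_of_nonneg (fun n => by positivity) hs.summable, hs.tsum_eq,
    ENNReal.ofReal_one]

/-- `μ*`: the law of the Poisson point process of intensity `μ`. Writing `μ = ∑ k, μ_k` with finite
measures `μ_k`, it is the law of the superposition of independent Poisson point processes of
intensities `μ_k`. -/
def poisson {X : Type*} [MeasurableSpace X] (μ : Measure X) [SFinite μ] :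
    Measure (Configuration X) :=
  (Measure.infinitePi fun k : ℕ => finitePoisson (sfiniteSeq μ k)).map Configuration.superpose

instance {X : Type*} [MeasurableSpace X] (μ : Measure X) [SFinite μ] :
    IsProbabilityMeasure (poisson μ) :=
  Measure.isProbabilityMeasure_map measurable_superpose.aemeasurable

theorem Aut.measurable_rep {X : Type*} [MeasurableSpace X] {μ : Measure X} (T : Aut μ) :
    Measurable T.rep :=
  (Quotient.out T : nonsingularPerm μ).2.1.measurable

/-- `S ∈ Aut(X*, μ*)` is the Poisson suspension `T_*` of `T ∈ Aut(X, μ)`, that is,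
`S ω = ω ∘ T⁻¹` for almost every configuration `ω`. -/
def IsSuspension {X : Type*} [MeasurableSpace X] {μ : Measure X} [SFinite μ]
    (T : Aut μ) (S : Aut (poisson μ)) : Prop :=
  ∀ᵐ ω ∂(poisson μ), S.rep ω = Configuration.map T.rep T.measurable_rep ω

end PoissonSuspension

end

open PoissonSuspension

/-! Write `P` for the Poisson law of intensity `μ` and `Q_γ` for its image under the inverse of
`γ_*`, which is the Poisson law of intensity `μ ∘ γ`. Put `g = dμ/d(μ ∘ γ)` and `e_γ = exp ∫ (g² -
1) dμ`. Everything rests on the inequality `P(D)³ ≤ e_γ Q_γ(D)²` for measurable `D`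
(`real_pow_three_le_map_suspension`). It is Hölder's inequality with exponents `3` and `3/2` for
`∫_D (dP/dQ_γ) dQ_γ`, the third moment of the density being `e_γ`.

The density itself is never constructed. Over a set `B` of finite measure the Poisson laws are
explicit sums of product measures, and Hölder gives the inequality with constant `exp (2 (μ(γB) -
μ(B)) + ∫_B (g² - 1) dμ)`. As `B` increases to `X` the first term tends to `2 χ(γ) = 0`, and
approximation by events that depend on some `B` only gives all events. Laplace functionals identify
the laws that occur here.

The inequality yields `P ≪ Q_γ`; used for `γ` and `γ⁻¹`, this makes `γ_*` nonsingular. It also gives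
conservativity. If `P(D) > 0`, then, since `b_γ² e_γ ≤ 1` for all but finitely many `γ`, `b_γ
P(D)^{3/2} ≤ Q_γ(D)` for these, so `∑ Q_γ(D) = ∞`. A set that each orbit visits at most `m` times
would have a finite sum (`isConservative_of_tsum_eq_top`). Since `γ ↦ γ_*` is injective, sums over
`Γ` and over `Γ_*` agree. -/

noncomputable section

namespace PoissonSuspension

open Filter Topology ProbabilityTheory
open scoped ENNReal

/-! ### The function `t ↦ e^{-t}` on `[0, ∞]` -/

/-- The function `t ↦ e^{-t}` on `[0, ∞]`. -/
def expNeg (t : ℝ≥0∞) : ℝ≥0∞ := EReal.exp (-(t : EReal))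

theorem expNeg_zero : expNeg 0 = 1 := by simp [expNeg]

theorem expNeg_top : expNeg ∞ = 0 := by simp [expNeg]

theorem expNeg_add (s t : ℝ≥0∞) : expNeg (s + t) = expNeg s * expNeg t := by
  rw [expNeg, expNeg, expNeg, ← EReal.exp_add, EReal.coe_ennreal_add, EReal.neg_add,
    sub_eq_add_neg]
  · exact Or.inl (EReal.coe_ennreal_ne_bot s)
  · exact Or.inr (EReal.coe_ennreal_ne_bot t)

theorem expNeg_sum {ι : Type*} (s : Finset ι) (f : ι → ℝ≥0∞) :
    expNeg (∑ i ∈ s, f i) = ∏ i ∈ s, expNeg (f i) := by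
  classical
  induction s using Finset.induction_on with
  | empty => simp [expNeg_zero]
  | insert a s ha ih => rw [Finset.sum_insert ha, Finset.prod_insert ha, expNeg_add, ih]

theorem expNeg_nsmul (n : ℕ) (t : ℝ≥0∞) : expNeg (n * t) = expNeg t ^ n := by
  have := expNeg_sum (Finset.range n) fun _ => t
  simpa using this

theorem expNeg_strictAnti : StrictAnti expNeg := fun s t h => by
  apply EReal.exp_strictMono
  rw [EReal.neg_lt_neg_iff]
  exact_mod_cast h

theorem expNeg_le_one (t : ℝ≥0∞) : expNeg t ≤ 1 :=
  expNeg_zero ▸ expNeg_strictAnti.antitone (zero_le (a := t))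

theorem expNeg_ne_top (t : ℝ≥0∞) : expNeg t ≠ ∞ :=
  ((expNeg_le_one t).trans_lt ENNReal.one_lt_top).ne

theorem continuous_expNeg : Continuous expNeg :=
  ENNReal.continuous_exp.comp (continuous_neg.comp continuous_coe_ennreal_ereal)

theorem measurable_expNeg : Measurable expNeg := continuous_expNeg.measurable

theorem expNeg_ofReal {x : ℝ} (hx : 0 ≤ x) :
    expNeg (ENNReal.ofReal x) = ENNReal.ofReal (Real.exp (-x)) := by
  rw [expNeg, EReal.coe_ennreal_ofReal, max_eq_left hx, ← EReal.coe_neg, EReal.exp_coe]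

theorem expNeg_tsum_nat (f : ℕ → ℝ≥0∞) :
    Tendsto (fun n => ∏ k ∈ Finset.range n, expNeg (f k)) atTop (𝓝 (expNeg (∑' k, f k))) := by
  simp_rw [← expNeg_sum]
  exact (continuous_expNeg.tendsto _).comp ENNReal.summable.hasSum.tendsto_sum_nat

/-! ### Products on finite powers of a measure space -/

theorem lintegral_pi_prod {X : Type*} [MeasurableSpace X] (ν : Measure X) [SigmaFinite ν]
    {n : ℕ} (f : Fin n → X → ℝ≥0∞) (hf : ∀ i, Measurable (f i)) :
    ∫⁻ x : Fin n → X, ∏ i, f i (x i) ∂(Measure.pi fun _ => ν) = ∏ i, ∫⁻ x, f i x ∂ν := by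
  induction n with
  | zero => simp
  | succ n ih =>
    rw [← ((measurePreserving_piFinSuccAbove (fun _ : Fin (n + 1) => ν) 0).symm).lintegral_comp_emb
      (MeasurableEquiv.measurableEmbedding _)]
    simp_rw [MeasurableEquiv.piFinSuccAbove_symm_apply, Fin.insertNthEquiv,
      Fin.prod_univ_succ, Fin.insertNth_zero, Equiv.coe_fn_mk, Fin.cons_succ, Fin.cons_zero]
    rw [← ih (fun i => f i.succ) fun i => hf i.succ]
    exact lintegral_prod_mul (hf 0).aemeasurable
      (Finset.measurable_fun_prod _ fun (i : Fin n) _ =>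
        (hf i.succ).comp (measurable_pi_apply i)).aemeasurable

theorem pi_withDensity {X : Type*} [MeasurableSpace X] (ν : Measure X) [SigmaFinite ν]
    {g : X → ℝ≥0∞} (hg : Measurable g) [SigmaFinite (ν.withDensity g)] (n : ℕ) :
    (Measure.pi fun _ : Fin n => ν.withDensity g) =
      (Measure.pi fun _ : Fin n => ν).withDensity fun x => ∏ i, g (x i) := by
  refine Measure.pi_eq fun s hs => ?_
  rw [withDensity_apply _ (MeasurableSet.univ_pi hs),
    ← lintegral_indicator (MeasurableSet.univ_pi hs)]
  simp_rw [withDensity_apply _ (hs _)]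
  rw [← Finset.prod_congr rfl fun i _ => lintegral_indicator (hs i) g,
    ← lintegral_pi_prod ν (fun i => (s i).indicator g) fun i => hg.indicator (hs i)]
  refine lintegral_congr fun x => ?_
  by_cases hx : x ∈ Set.univ.pi s
  · rw [Set.indicator_of_mem hx]
    exact Finset.prod_congr rfl fun i _ => (Set.indicator_of_mem (hx i (Set.mem_univ i)) g).symm
  · rw [Set.indicator_of_notMem hx]
    simp only [Set.mem_pi, Set.mem_univ, true_imp_iff, not_forall] at hx
    obtain ⟨i, hi⟩ := hx
    exact (Finset.prod_eq_zero (Finset.mem_univ i) (Set.indicator_of_notMem hi g)).symm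

theorem tsum_ofReal_exp_div_factorial_mul_pow (a : ℝ) {c : ℝ≥0∞} (hc : c ≠ ∞) :
    ∑' n : ℕ, ENNReal.ofReal (Real.exp (-a) / n.factorial) * c ^ n =
      ENNReal.ofReal (Real.exp (c.toReal - a)) := by
  have hs : HasSum (fun n : ℕ => Real.exp (-a) * (c.toReal ^ n / n.factorial))
      (Real.exp (c.toReal - a)) := by
    have h1 := (NormedSpace.expSeries_div_hasSum_exp c.toReal).mul_left (Real.exp (-a))
    rwa [← Real.exp_eq_exp_ℝ, ← Real.exp_add, neg_add_eq_sub] at h1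
  rw [← hs.tsum_eq, ENNReal.ofReal_tsum_of_nonneg (fun n => by positivity) hs.summable]
  refine tsum_congr fun n => ?_
  conv_lhs => rw [← ENNReal.ofReal_toReal hc]
  rw [← ENNReal.ofReal_pow ENNReal.toReal_nonneg, ← ENNReal.ofReal_mul (by positivity)]
  congr 1
  ring

/-! ### The Laplace functional -/

/-- The Laplace functional `ω ↦ exp (-∫ g dω)`. -/
def Configuration.laplace {X : Type*} [MeasurableSpace X] (g : X → ℝ≥0∞)
    (ω : Configuration X) : ℝ≥0∞ :=
  expNeg (∫⁻ x, g x ∂ω.1)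

theorem measurable_laplace {X : Type*} [MeasurableSpace X] {g : X → ℝ≥0∞} (hg : Measurable g) :
    Measurable (Configuration.laplace g) :=
  measurable_expNeg.comp ((Measure.measurable_lintegral hg).comp measurable_subtype_coe)

/-- On `n` points the functional factorizes, so its integral is `cⁿ` with `c = ∫ e^{-g} dν`. Summing
the exponential series gives `e^{c - ν(X)}`. -/
theorem lintegral_laplace_finitePoisson {X : Type*} [MeasurableSpace X] (ν : Measure X)
    [IsFiniteMeasure ν] {g : X → ℝ≥0∞} (hg : Measurable g) :
    ∫⁻ ω, Configuration.laplace g ω ∂(finitePoisson ν) =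
      expNeg (∫⁻ x, (1 - expNeg (g x)) ∂ν) := by
  have hm : Measurable fun x => expNeg (g x) := measurable_expNeg.comp hg
  have hle : ∫⁻ x, expNeg (g x) ∂ν ≤ ν Set.univ :=
    (lintegral_mono fun x => expNeg_le_one (g x)).trans_eq (by simp)
  have hc : ∫⁻ x, expNeg (g x) ∂ν ≠ ∞ := (hle.trans_lt (measure_lt_top ν _)).ne
  have h : ∀ n : ℕ, ∫⁻ ω, Configuration.laplace g ω
      ∂(Measure.pi fun _ : Fin n => ν).map (Configuration.ofPoints n) =
      (∫⁻ x, expNeg (g x) ∂ν) ^ n := by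
    intro n
    rw [lintegral_map (measurable_laplace hg) (measurable_ofPoints n)]
    have : ∀ x : Fin n → X, Configuration.laplace g (Configuration.ofPoints n x) =
        ∏ i, expNeg (g (x i)) := by
      intro x
      rw [Configuration.laplace, Configuration.ofPoints, lintegral_sum_measure,
        tsum_fintype, expNeg_sum]
      simp_rw [lintegral_dirac' _ hg]
    simp_rw [this]
    rw [lintegral_pi_prod ν (fun _ x => expNeg (g x)) fun _ => hm]
    simp
  rw [finitePoisson, lintegral_sum_measure]
  simp_rw [lintegral_smul_measure, h, smul_eq_mul]
  rw [tsum_ofReal_exp_div_factorial_mul_pow _ hc, lintegral_sub hm hc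
    (Eventually.of_forall fun x => expNeg_le_one (g x)), lintegral_one,
    ← ENNReal.ofReal_toReal (ENNReal.sub_ne_top (measure_ne_top ν _)),
    expNeg_ofReal ENNReal.toReal_nonneg, ENNReal.toReal_sub_of_le hle (measure_ne_top ν _),
    neg_sub, measureReal_def]

theorem lintegral_laplace_poisson {X : Type*} [MeasurableSpace X] (μ : Measure X) [SFinite μ]
    {g : X → ℝ≥0∞} (hg : Measurable g) :
    ∫⁻ ω, Configuration.laplace g ω ∂(poisson μ) = expNeg (∫⁻ x, (1 - expNeg (g x)) ∂μ) := by
  rw [poisson, lintegral_map (measurable_laplace hg) measurable_superpose]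
  have hcoord : ∀ k, Measurable fun ω : ℕ → Configuration X => Configuration.laplace g (ω k) :=
    fun k => (measurable_laplace hg).comp (measurable_pi_apply k)
  have h1 : ∀ n : ℕ, ∫⁻ ω, ∏ k ∈ Finset.range n, Configuration.laplace g (ω k)
      ∂(Measure.infinitePi fun k : ℕ => finitePoisson (sfiniteSeq μ k)) =
      ∏ k ∈ Finset.range n, expNeg (∫⁻ x, (1 - expNeg (g x)) ∂(sfiniteSeq μ k)) := by
    intro n
    rw [lintegral_prod_eq_prod_lintegral_of_indepFun (Finset.range n)
      (fun k (ω : ℕ → Configuration X) => Configuration.laplace g (ω k))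
      (iIndepFun_infinitePi fun _ => measurable_laplace hg) hcoord]
    refine Finset.prod_congr rfl fun k _ => ?_
    rw [← lintegral_laplace_finitePoisson _ hg,
      ← Measure.infinitePi_map_eval (fun k : ℕ => finitePoisson (sfiniteSeq μ k)) k,
      lintegral_map (measurable_laplace hg) (measurable_pi_apply k)]
  have h2 : Tendsto (fun n : ℕ => ∫⁻ ω, ∏ k ∈ Finset.range n, Configuration.laplace g (ω k)
      ∂(Measure.infinitePi fun k : ℕ => finitePoisson (sfiniteSeq μ k))) atTop
      (𝓝 (∫⁻ ω, Configuration.laplace g (Configuration.superpose ω)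
        ∂(Measure.infinitePi fun k : ℕ => finitePoisson (sfiniteSeq μ k)))) := by
    -- The partial products, whose integrals split by independence, are bounded by `1` and converge
    -- to the functional of the superposition.
    refine tendsto_lintegral_of_dominated_convergence (fun _ => 1)
      (fun n => Finset.measurable_prod _ fun k _ => hcoord k)
      (fun n => Eventually.of_forall fun ω => Finset.prod_le_one' fun k _ => expNeg_le_one _)
      (by simp) (Eventually.of_forall fun ω => ?_)
    have := expNeg_tsum_nat fun k => ∫⁻ x, g x ∂(ω k).1
    rwa [← lintegral_sum_measure] at this
  have h3 := expNeg_tsum_nat fun k => ∫⁻ x, (1 - expNeg (g x)) ∂(sfiniteSeq μ k)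
  rw [← lintegral_sum_measure, sum_sfiniteSeq] at h3
  simp_rw [h1] at h2
  exact tendsto_nhds_unique h2 h3

/-! ### The Laplace functional determines the law -/

/-- The function `x ↦ e^{-x i}` on `[0, ∞]^S`, as a bounded continuous function. -/
def expNegCoord {S : Type*} (i : S) : BoundedContinuousFunction (S → ℝ≥0∞) ℝ :=
  BoundedContinuousFunction.ofNormedAddCommGroup (fun x => (expNeg (x i)).toReal)
    (by
      refine continuous_iff_continuousAt.2 fun x => ?_
      exact (ENNReal.tendsto_toReal (expNeg_ne_top _)).comp
        ((continuous_expNeg.comp (continuous_apply i)).tendsto x))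
    1 (by
      intro x
      rw [Real.norm_of_nonneg ENNReal.toReal_nonneg]
      exact ENNReal.toReal_mono ENNReal.one_ne_top (expNeg_le_one _))

theorem expNegCoord_apply {S : Type*} (i : S) (x : S → ℝ≥0∞) :
    expNegCoord i x = (expNeg (x i)).toReal := rfl

theorem exists_eq_prod_of_mem_closure_expNegCoord {S : Type*} [Fintype S]
    {m : BoundedContinuousFunction (S → ℝ≥0∞) ℝ}
    (hm : m ∈ Submonoid.closure (Set.range (expNegCoord (S := S)))) :
    ∃ n : S → ℕ, ∀ x, m x = (∏ i, expNeg (x i) ^ n i).toReal := by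
  classical
  induction hm using Submonoid.closure_induction with
  | mem m hm =>
    obtain ⟨j, rfl⟩ := hm
    refine ⟨Pi.single j 1, fun x => ?_⟩
    rw [Finset.prod_eq_single j (fun i _ hi => by simp [hi]) (by simp), expNegCoord_apply]
    simp
  | one => exact ⟨0, fun x => by simp⟩
  | mul m m' _ _ h h' =>
    obtain ⟨n, hn⟩ := h
    obtain ⟨n', hn'⟩ := h'
    refine ⟨n + n', fun x => ?_⟩
    rw [BoundedContinuousFunction.mul_apply, hn, hn', ← ENNReal.toReal_mul,
      ← Finset.prod_mul_distrib]
    simp_rw [Pi.add_apply, pow_add]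

/-- The functions `e^{-x i}` separate the points of the Polish space `[0, ∞]^S`, so the algebra that
they generate determines finite measures. This algebra is spanned by the monomials in the
hypothesis. -/
theorem ext_of_lintegral_prod_expNeg_pow {S : Type*} [Fintype S] {P Q : Measure (S → ℝ≥0∞)}
    [IsFiniteMeasure P] [IsFiniteMeasure Q]
    (h : ∀ n : S → ℕ, ∫⁻ x, ∏ i, expNeg (x i) ^ n i ∂P = ∫⁻ x, ∏ i, expNeg (x i) ^ n i ∂Q) :
    P = Q := by
  let A : StarSubalgebra ℝ (BoundedContinuousFunction (S → ℝ≥0∞) ℝ) :=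
    { Algebra.adjoin ℝ (Set.range (expNegCoord (S := S))) with
      star_mem' := fun {a} ha => by
        have : star a = a := by ext x; simp
        rwa [this] }
  refine ext_of_forall_mem_subalgebra_integral_eq_of_polish (𝕜 := ℝ) (A := A) ?_ ?_
  · intro x y hxy
    obtain ⟨i, hi⟩ := Function.ne_iff.1 hxy
    refine ⟨expNegCoord i, ⟨(expNegCoord i).toContinuousMap, ⟨expNegCoord i,
      Algebra.subset_adjoin ⟨i, rfl⟩, rfl⟩, rfl⟩, fun hxy' => hi ?_⟩
    simp only [expNegCoord_apply] at hxy'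
    exact expNeg_strictAnti.injective
      ((ENNReal.toReal_eq_toReal_iff' (expNeg_ne_top _) (expNeg_ne_top _)).1 hxy')
  · intro f hfA
    have hf : f ∈ Submodule.span ℝ
        (Submonoid.closure (Set.range (expNegCoord (S := S))) :
          Set (BoundedContinuousFunction (S → ℝ≥0∞) ℝ)) := by
      rw [← Algebra.adjoin_eq_span]
      exact hfA
    clear hfA
    induction hf using Submodule.span_induction with
    | mem m hm =>
      obtain ⟨n, hn⟩ := exists_eq_prod_of_mem_closure_expNegCoord hm
      have hmeas : Measurable fun x : S → ℝ≥0∞ => ∏ i, expNeg (x i) ^ n i :=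
        Finset.measurable_fun_prod _ fun i _ =>
          (measurable_expNeg.comp (measurable_pi_apply i)).pow_const _
      have hlt : ∀ x : S → ℝ≥0∞, ∏ i, expNeg (x i) ^ n i < ∞ := fun x =>
        (Finset.prod_le_one' fun i _ => pow_le_one' (expNeg_le_one _) _).trans_lt
          ENNReal.one_lt_top
      simp_rw [hn]
      rw [integral_toReal hmeas.aemeasurable (Eventually.of_forall hlt),
        integral_toReal hmeas.aemeasurable (Eventually.of_forall hlt), h]
    | zero => simp
    | add f g _ _ hf hg =>
      simp only [BoundedContinuousFunction.add_apply]
      rw [integral_add (f.integrable _) (g.integrable _),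
        integral_add (f.integrable _) (g.integrable _), hf, hg]
    | smul c f _ hf =>
      simp only [BoundedContinuousFunction.smul_apply]
      rw [integral_smul, integral_smul, hf]

theorem Configuration.measurable_apply {X : Type*} [MeasurableSpace X] {B : Set X}
    (hB : MeasurableSet B) : Measurable fun ω : Configuration X => ω.1 B :=
  (Measure.measurable_coe hB).comp measurable_subtype_coe

/-- The values of a configuration on all measurable sets. -/
def Configuration.values {X : Type*} [MeasurableSpace X] (ω : Configuration X) :
    {B : Set X // MeasurableSet B} → ℝ≥0∞ :=
  fun B => ω.1 B

theorem Configuration.measurable_values {X : Type*} [MeasurableSpace X] :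
    Measurable (Configuration.values (X := X)) :=
  measurable_pi_lambda _ fun B => Configuration.measurable_apply B.2

theorem Configuration.measurableSpace_eq_comap_values {X : Type*} [MeasurableSpace X] :
    (inferInstance : MeasurableSpace (Configuration X)) =
      MeasurableSpace.comap Configuration.values MeasurableSpace.pi := by
  refine le_antisymm ?_ Configuration.measurable_values.comap_le
  refine Measurable.comap_le (Measure.measurable_of_measurable_coe _ fun B hB => ?_)
  exact (measurable_pi_apply (⟨B, hB⟩ : {B : Set X // MeasurableSet B})).comp
    (comap_measurable Configuration.values)

/-- For `g = ∑ n_B 1_B` the Laplace functional is the monomial `∏ (e^{-ω(B)})^{n_B}`. Hence the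
joint laws of finitely many values `ω(B)` are determined, and these values generate the σ-algebra.
-/
theorem ext_of_lintegral_laplace {X : Type*} [MeasurableSpace X]
    {P Q : Measure (Configuration X)} [IsFiniteMeasure P] [IsFiniteMeasure Q]
    (h : ∀ g : X → ℝ≥0∞, Measurable g →
      ∫⁻ ω, Configuration.laplace g ω ∂P = ∫⁻ ω, Configuration.laplace g ω ∂Q) :
    P = Q := by
  have hmap : P.map Configuration.values = Q.map Configuration.values := by
    refine IsProjectiveLimit.unique (P := fun S => (Q.map Configuration.values).map S.restrict)
      (fun S => ?_) (fun S => rfl)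
    refine ext_of_lintegral_prod_expNeg_pow fun n => ?_
    have hprod : Measurable fun x : S → ℝ≥0∞ => ∏ i, expNeg (x i) ^ n i :=
      Finset.measurable_fun_prod _ fun i _ =>
        (measurable_expNeg.comp (measurable_pi_apply i)).pow_const _
    have hind : ∀ B : S, Measurable (B.1.1.indicator fun _ => (n B : ℝ≥0∞)) := fun B =>
      measurable_const.indicator B.1.2
    have key : ∀ ω : Configuration X,
        ∏ i : S, expNeg (S.restrict (Configuration.values ω) i) ^ n i =
          Configuration.laplace
            (fun x => ∑ B : S, B.1.1.indicator (fun _ => (n B : ℝ≥0∞)) x) ω := by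
      intro ω
      rw [Configuration.laplace, lintegral_finsetSum _ fun B _ => hind B, expNeg_sum]
      refine Finset.prod_congr rfl fun B _ => ?_
      rw [lintegral_indicator_const B.1.2, expNeg_nsmul]
      rfl
    have hlap : ∀ ρ : Measure (Configuration X),
        ∫⁻ x, ∏ i, expNeg (x i) ^ n i ∂((ρ.map Configuration.values).map S.restrict) =
          ∫⁻ ω, Configuration.laplace
            (fun x => ∑ B : S, B.1.1.indicator (fun _ => (n B : ℝ≥0∞)) x) ω ∂ρ := by
      intro ρ
      rw [Measure.map_map (Finset.measurable_restrict S) Configuration.measurable_values,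
        lintegral_map hprod
          ((Finset.measurable_restrict S).comp Configuration.measurable_values)]
      exact lintegral_congr key
    exact (hlap P).trans ((h _ (Finset.measurable_fun_sum _ fun B _ => hind B)).trans
      (hlap Q).symm)
  refine Measure.ext fun s hs => ?_
  obtain ⟨t, ht, rfl⟩ := Configuration.measurableSpace_eq_comap_values.le s hs
  rw [← Measure.map_apply Configuration.measurable_values ht, hmap,
    Measure.map_apply Configuration.measurable_values ht]

/-! ### Poisson laws -/

/-- `P` has the Laplace functional of the Poisson point process of intensity `μ`. -/
def IsPoissonLaw {X : Type*} [MeasurableSpace X] (P : Measure (Configuration X))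
    (μ : Measure X) : Prop :=
  ∀ g : X → ℝ≥0∞, Measurable g →
    ∫⁻ ω, Configuration.laplace g ω ∂P = expNeg (∫⁻ x, (1 - expNeg (g x)) ∂μ)

theorem isPoissonLaw_poisson {X : Type*} [MeasurableSpace X] (μ : Measure X) [SFinite μ] :
    IsPoissonLaw (poisson μ) μ :=
  fun _ hg => lintegral_laplace_poisson μ hg

theorem isPoissonLaw_finitePoisson {X : Type*} [MeasurableSpace X] (ν : Measure X)
    [IsFiniteMeasure ν] : IsPoissonLaw (finitePoisson ν) ν :=
  fun _ hg => lintegral_laplace_finitePoisson ν hg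

theorem IsPoissonLaw.isProbabilityMeasure {X : Type*} [MeasurableSpace X]
    {P : Measure (Configuration X)} {μ : Measure X} (hP : IsPoissonLaw P μ) :
    IsProbabilityMeasure P := by
  constructor
  simpa [Configuration.laplace, expNeg_zero] using hP 0 measurable_zero

theorem IsPoissonLaw.unique {X : Type*} [MeasurableSpace X] {P Q : Measure (Configuration X)}
    {μ : Measure X} (hP : IsPoissonLaw P μ) (hQ : IsPoissonLaw Q μ) : P = Q := by
  have := hP.isProbabilityMeasure
  have := hQ.isProbabilityMeasure
  exact ext_of_lintegral_laplace fun g hg => (hP g hg).trans (hQ g hg).symm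

theorem Configuration.measurable_map {X : Type*} [MeasurableSpace X] (T : X → X)
    (hT : Measurable T) : Measurable (Configuration.map T hT) := by
  refine Measurable.subtype_mk (Measure.measurable_of_measurable_coe _ fun s hs => ?_)
  simp_rw [Measure.map_apply hT hs]
  exact Configuration.measurable_apply (hT hs)

theorem IsPoissonLaw.map {X : Type*} [MeasurableSpace X] {P : Measure (Configuration X)}
    {μ : Measure X} (hP : IsPoissonLaw P μ) {T : X → X} (hT : Measurable T) :
    IsPoissonLaw (P.map (Configuration.map T hT)) (μ.map T) := by
  intro g hg
  have hm : Measurable fun x => 1 - expNeg (g x) :=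
    measurable_const.sub (measurable_expNeg.comp hg)
  rw [lintegral_map (measurable_laplace hg) (Configuration.measurable_map T hT),
    lintegral_map hm hT]
  refine Eq.trans (lintegral_congr fun ω => ?_) (hP _ (hg.comp hT))
  rw [Configuration.laplace, Configuration.laplace, Configuration.map, lintegral_map hg hT]

/-- The restriction of a configuration to a measurable set. -/
def Configuration.restrict {X : Type*} [MeasurableSpace X] (B : Set X) (hB : MeasurableSet B)
    (ω : Configuration X) : Configuration X :=
  ⟨ω.1.restrict B, by
    classical
    obtain ⟨ι, hι, x, hx⟩ := ω.2
    refine ⟨{i : ι // x i ∈ B}, inferInstance, fun i => x i, ?_⟩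
    rw [hx, Measure.restrict_sum _ hB]
    ext s hs
    rw [Measure.sum_apply _ hs, Measure.sum_apply _ hs]
    simp_rw [restrict_dirac' hB]
    rw [← tsum_subtype_eq_of_support_subset (s := {i | x i ∈ B})]
    · exact tsum_congr fun i => by rw [if_pos (show x i ∈ B from i.2)]
    · intro i hi
      by_contra h
      exact hi (by simp [show x i ∉ B from h])⟩

theorem Configuration.measurable_restrict {X : Type*} [MeasurableSpace X] {B : Set X}
    (hB : MeasurableSet B) : Measurable (Configuration.restrict B hB) := by
  refine Measurable.subtype_mk (Measure.measurable_of_measurable_coe _ fun s hs => ?_)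
  simp_rw [Measure.restrict_apply hs]
  exact Configuration.measurable_apply (hs.inter hB)

theorem IsPoissonLaw.restrict {X : Type*} [MeasurableSpace X] {P : Measure (Configuration X)}
    {μ : Measure X} (hP : IsPoissonLaw P μ) {B : Set X} (hB : MeasurableSet B) :
    IsPoissonLaw (P.map (Configuration.restrict B hB)) (μ.restrict B) := by
  intro g hg
  rw [lintegral_map (measurable_laplace hg) (Configuration.measurable_restrict hB),
    ← lintegral_indicator hB]
  have h1 : ∀ ω, Configuration.laplace g (Configuration.restrict B hB ω) =
      Configuration.laplace (B.indicator g) ω := by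
    intro ω
    rw [Configuration.laplace, Configuration.laplace, Configuration.restrict,
      lintegral_indicator hB]
  simp_rw [h1]
  rw [hP _ (hg.indicator hB)]
  congr 1
  refine lintegral_congr fun x => ?_
  by_cases hx : x ∈ B <;> simp [hx, expNeg_zero]

/-- This replaces a Poisson law of possibly infinite intensity, seen through a set of finite
measure, by the explicit series `finitePoisson`. -/
theorem IsPoissonLaw.map_restrict_eq {X : Type*} [MeasurableSpace X]
    {P : Measure (Configuration X)} {μ : Measure X} (hP : IsPoissonLaw P μ) {B : Set X}
    (hB : MeasurableSet B) [IsFiniteMeasure (μ.restrict B)] :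
    P.map (Configuration.restrict B hB) = finitePoisson (μ.restrict B) :=
  (hP.restrict hB).unique (isPoissonLaw_finitePoisson _)

/-- Void probabilities. -/
theorem IsPoissonLaw.measure_apply_eq_zero {X : Type*} [MeasurableSpace X]
    {P : Measure (Configuration X)} {μ : Measure X} (hP : IsPoissonLaw P μ) {A : Set X}
    (hA : MeasurableSet A) : P {ω | ω.1 A = 0} = expNeg (μ A) := by
  -- With the value `∞` on `A`, the functional `e^{-∞ · ω(A)}` is the indicator of the event that
  -- `A` carries no point.
  have h := hP (A.indicator fun _ => ∞) (measurable_const.indicator hA)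
  have h1 : ∀ ω : Configuration X, Configuration.laplace (A.indicator fun _ => ∞) ω =
      {ω : Configuration X | ω.1 A = 0}.indicator 1 ω := by
    intro ω
    rw [Configuration.laplace, lintegral_indicator_const hA]
    by_cases hω : ω.1 A = 0
    · simp [hω, expNeg_zero]
    · simp [hω, expNeg_top]
  have h2 : ∀ x, 1 - expNeg (A.indicator (fun _ => ∞) x) = A.indicator 1 x := by
    intro x
    by_cases hx : x ∈ A <;> simp [hx, expNeg_zero, expNeg_top]
  simp_rw [h1, h2] at h
  have hm : MeasurableSet {ω : Configuration X | ω.1 A = 0} :=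
    Configuration.measurable_apply hA (measurableSet_singleton 0)
  rwa [lintegral_indicator_one hA, lintegral_indicator_one hm] at h

theorem IsPoissonLaw.ae_apply_eq_zero {X : Type*} [MeasurableSpace X]
    {P : Measure (Configuration X)} {μ : Measure X} (hP : IsPoissonLaw P μ) {A : Set X}
    (hA : μ A = 0) : ∀ᵐ ω ∂P, ω.1 A = 0 := by
  have := hP.isProbabilityMeasure
  have hm : MeasurableSet (toMeasurable μ A) := measurableSet_toMeasurable μ A
  have h : P {ω | ω.1 (toMeasurable μ A) = 0} = 1 := by
    rw [hP.measure_apply_eq_zero hm, measure_toMeasurable, hA, expNeg_zero]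
  have h' : ∀ᵐ ω ∂P, ω.1 (toMeasurable μ A) = 0 :=
    (prob_compl_eq_zero_iff (Configuration.measurable_apply hm (measurableSet_singleton 0))).2 h
  filter_upwards [h'] with ω hω
  exact measure_mono_null (subset_toMeasurable μ A) hω

/-! ### Hölder's inequality for Poisson laws with a density -/

theorem lintegral_pow_three_le {α : Type*} [MeasurableSpace α] (m : Measure α)
    {f g h : α → ℝ≥0∞} (hf : AEMeasurable f m) (hg : AEMeasurable g m)
    (hle : ∀ x, h x ^ 3 ≤ f x * g x ^ 2) :
    (∫⁻ x, h x ∂m) ^ 3 ≤ (∫⁻ x, f x ∂m) * (∫⁻ x, g x ∂m) ^ 2 := by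
  have hroot : ∀ a b c : ℝ≥0∞, a ^ 3 ≤ b * c ^ 2 →
      a ≤ b ^ (1 / 3 : ℝ) * c ^ (2 / 3 : ℝ) := by
    intro a b c habc
    have h1 := ENNReal.rpow_le_rpow habc (show (0 : ℝ) ≤ 1 / 3 by norm_num)
    rw [ENNReal.mul_rpow_of_nonneg _ _ (by norm_num), ← ENNReal.rpow_natCast,
      ← ENNReal.rpow_natCast, ← ENNReal.rpow_mul, ← ENNReal.rpow_mul] at h1
    norm_num at h1
    exact h1
  have h2 : ∫⁻ x, h x ∂m ≤
      (∫⁻ x, f x ∂m) ^ (1 / 3 : ℝ) * (∫⁻ x, g x ∂m) ^ (2 / 3 : ℝ) :=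
    (lintegral_mono fun x => hroot _ _ _ (hle x)).trans
      (ENNReal.lintegral_mul_norm_pow_le hf hg (by norm_num) (by norm_num) (by norm_num))
  refine (pow_le_pow_left' h2 3).trans_eq ?_
  rw [mul_pow, ← ENNReal.rpow_natCast, ← ENNReal.rpow_natCast, ← ENNReal.rpow_natCast,
    ← ENNReal.rpow_mul, ← ENNReal.rpow_mul]
  norm_num

theorem tsum_pow_three_le {f g h : ℕ → ℝ≥0∞} (hle : ∀ n, h n ^ 3 ≤ f n * g n ^ 2) :
    (∑' n, h n) ^ 3 ≤ (∑' n, f n) * (∑' n, g n) ^ 2 := by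
  simpa only [lintegral_count] using lintegral_pow_three_le Measure.count
    (measurable_from_nat (f := f)).aemeasurable (measurable_from_nat (f := g)).aemeasurable hle

theorem finitePoisson_apply {X : Type*} [MeasurableSpace X] (ν : Measure X) [IsFiniteMeasure ν]
    {D : Set (Configuration X)} (hD : MeasurableSet D) :
    finitePoisson ν D = ∑' n : ℕ, ENNReal.ofReal (Real.exp (-(ν.real Set.univ)) / n.factorial) *
      (Measure.pi fun _ : Fin n => ν) (Configuration.ofPoints n ⁻¹' D) := by
  rw [finitePoisson, Measure.sum_apply _ hD]
  refine tsum_congr fun n => ?_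
  rw [Measure.smul_apply, Measure.map_apply (measurable_ofPoints n) hD, smul_eq_mul]

/-- Hölder is used twice: on each power `Xⁿ`, where the density is `∏ g(x i)`, and then in the sum
over the number `n` of points. -/
theorem finitePoisson_pow_three_le {X : Type*} [MeasurableSpace X] (ν ν' : Measure X)
    [IsFiniteMeasure ν] [IsFiniteMeasure ν'] {g : X → ℝ≥0∞} (hg : Measurable g)
    (hν : ν = ν'.withDensity g) (hg3 : ∫⁻ x, g x ^ 3 ∂ν' ≠ ∞)
    {D : Set (Configuration X)} (hD : MeasurableSet D) :
    finitePoisson ν D ^ 3 ≤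
      ENNReal.ofReal (Real.exp (2 * ν'.real Set.univ - 3 * ν.real Set.univ +
        (∫⁻ x, g x ^ 3 ∂ν').toReal)) * finitePoisson ν' D ^ 2 := by
  set a := ν.real Set.univ with ha
  set a' := ν'.real Set.univ with ha'
  set c := ∫⁻ x, g x ^ 3 ∂ν' with hc
  set p : ℕ → ℝ≥0∞ := fun n => (Measure.pi fun _ : Fin n => ν) (Configuration.ofPoints n ⁻¹' D)
  set q : ℕ → ℝ≥0∞ := fun n => (Measure.pi fun _ : Fin n => ν') (Configuration.ofPoints n ⁻¹' D)
  have hpq : ∀ n, p n ^ 3 ≤ c ^ n * q n ^ 2 := by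
    intro n
    have hS : MeasurableSet (Configuration.ofPoints n ⁻¹' D) := measurable_ofPoints n hD
    have : SigmaFinite (ν'.withDensity g) := hν ▸ inferInstance
    have hp : p n = ∫⁻ x in Configuration.ofPoints n ⁻¹' D, ∏ i, g (x i)
        ∂(Measure.pi fun _ : Fin n => ν') := by
      rw [← withDensity_apply _ hS, ← pi_withDensity ν' hg]
      simp only [p, hν]
    have hm : Measurable fun x : Fin n → X => ∏ i, g (x i) ^ 3 :=
      Finset.measurable_fun_prod _ fun i _ => (hg.comp (measurable_pi_apply i)).pow_const 3
    have h1 := lintegral_pow_three_le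
      ((Measure.pi fun _ : Fin n => ν').restrict (Configuration.ofPoints n ⁻¹' D))
      (f := fun x => ∏ i, g (x i) ^ 3) (g := fun _ => 1) (h := fun x => ∏ i, g (x i))
      hm.aemeasurable aemeasurable_const (fun x => by simp [Finset.prod_pow])
    rw [← hp, lintegral_one, Measure.restrict_apply_univ] at h1
    refine h1.trans (mul_le_mul_left ?_ _)
    refine (setLIntegral_le_lintegral _ _).trans_eq ?_
    rw [lintegral_pi_prod ν' (fun _ x => g x ^ 3) fun _ => hg.pow_const 3]
    simp [hc]
  set r : ℕ → ℝ≥0∞ := fun n => ENNReal.ofReal (Real.exp (-a) / n.factorial) with hr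
  set r' : ℕ → ℝ≥0∞ := fun n => ENNReal.ofReal (Real.exp (-a') / n.factorial) with hr'
  -- These weights are chosen so that `r³ = s r'²`. The series `∑ s n cⁿ` then sums to the constant
  -- in the statement.
  set s : ℕ → ℝ≥0∞ := fun n =>
    ENNReal.ofReal (Real.exp (-(3 * a - 2 * a')) / n.factorial) with hs
  have hrs : ∀ n, r n ^ 3 = s n * r' n ^ 2 := by
    intro n
    simp only [hr, hs, hr']
    rw [← ENNReal.ofReal_pow (by positivity), ← ENNReal.ofReal_pow (by positivity),
      ← ENNReal.ofReal_mul (by positivity), div_pow, div_pow, ← Real.exp_nat_mul,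
      ← Real.exp_nat_mul, div_mul_div_comm, ← Real.exp_add, ← pow_succ']
    congr 3
    push_cast
    ring
  have h2 := tsum_pow_three_le (f := fun n => s n * c ^ n) (g := fun n => r' n * q n)
    (h := fun n => r n * p n) (fun n => by
      rw [mul_pow, hrs, mul_pow]
      calc s n * r' n ^ 2 * p n ^ 3 ≤ s n * r' n ^ 2 * (c ^ n * q n ^ 2) :=
            mul_le_mul_right (hpq n) _
        _ = s n * c ^ n * (r' n ^ 2 * q n ^ 2) := by ring)
  rw [tsum_ofReal_exp_div_factorial_mul_pow _ hg3] at h2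
  rw [finitePoisson_apply ν hD, finitePoisson_apply ν' hD]
  refine h2.trans_eq ?_
  congr 3
  ring

/-! ### Local sets of configurations -/

/-- The sets of configurations that depend on the restriction to some `B n` only. -/
def localSets {X : Type*} [MeasurableSpace X] (B : ℕ → Set X) (hB : ∀ n, MeasurableSet (B n)) :
    Set (Set (Configuration X)) :=
  {D | ∃ n, ∃ D', MeasurableSet D' ∧ D = Configuration.restrict (B n) (hB n) ⁻¹' D'}

theorem Configuration.restrict_restrict {X : Type*} [MeasurableSpace X] {A B : Set X}
    (hA : MeasurableSet A) (hB : MeasurableSet B) (hAB : A ⊆ B) (ω : Configuration X) :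
    Configuration.restrict A hA (Configuration.restrict B hB ω) =
      Configuration.restrict A hA ω :=
  Subtype.ext (Measure.restrict_restrict_of_subset hAB)

theorem eventually_exists_eq_restrict_preimage {X : Type*} [MeasurableSpace X] {B : ℕ → Set X}
    {hB : ∀ n, MeasurableSet (B n)} (hmono : Monotone B) {D : Set (Configuration X)}
    (hD : D ∈ localSets B hB) : ∀ᶠ n in atTop, ∃ D', MeasurableSet D' ∧
      D = Configuration.restrict (B n) (hB n) ⁻¹' D' := by
  obtain ⟨m, D', hD', rfl⟩ := hD
  filter_upwards [eventually_ge_atTop m] with n hn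
  refine ⟨_, Configuration.measurable_restrict (hB m) hD', ?_⟩
  ext ω
  simp only [Set.mem_preimage, Configuration.restrict_restrict (hB m) (hB n) (hmono hn)]

theorem isSetAlgebra_localSets {X : Type*} [MeasurableSpace X] {B : ℕ → Set X}
    (hB : ∀ n, MeasurableSet (B n)) (hmono : Monotone B) : IsSetAlgebra (localSets B hB) where
  empty_mem := ⟨0, ∅, MeasurableSet.empty, rfl⟩
  compl_mem := by
    rintro _ ⟨n, D', hD', rfl⟩
    exact ⟨n, D'ᶜ, hD'.compl, rfl⟩
  union_mem := by
    intro D E hD hE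
    obtain ⟨n, ⟨D', hD', rfl⟩, E', hE', rfl⟩ :=
      ((eventually_exists_eq_restrict_preimage hmono hD).and
        (eventually_exists_eq_restrict_preimage hmono hE)).exists
    exact ⟨n, D' ∪ E', hD'.union hE', rfl⟩

theorem generateFrom_localSets {X : Type*} [MeasurableSpace X] {B : ℕ → Set X}
    (hB : ∀ n, MeasurableSet (B n)) (hmono : Monotone B) (hU : ⋃ n, B n = Set.univ) :
    (inferInstance : MeasurableSpace (Configuration X)) =
      MeasurableSpace.generateFrom (localSets B hB) := by
  refine le_antisymm ?_ (MeasurableSpace.generateFrom_le ?_)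
  · refine Measurable.comap_le (Measure.measurable_of_measurable_coe _ fun A hA => ?_)
    have h : ∀ ω : Configuration X,
        ω.1 A = ⨆ n, (Configuration.restrict (B n) (hB n) ω).1 A := by
      intro ω
      have : A = ⋃ n, A ∩ B n := by rw [← Set.inter_iUnion, hU, Set.inter_univ]
      conv_lhs => rw [this]
      rw [Monotone.measure_iUnion fun m n hmn => Set.inter_subset_inter_right A (hmono hmn)]
      exact iSup_congr fun n => (Measure.restrict_apply hA).symm
    rw [show (fun ω : Configuration X => ω.1 A) = _ from funext h]
    refine Measurable.iSup fun n => ?_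
    intro S hS
    exact MeasurableSpace.measurableSet_generateFrom
      ⟨n, _, Configuration.measurable_apply hA hS, rfl⟩
  · rintro _ ⟨n, D', hD', rfl⟩
    exact Configuration.measurable_restrict (hB n) hD'

/-- Every measurable set is approximated by members of the algebra in `P + Q`, hence in `P` and in
`Q` at once, and both sides of the inequality are continuous under this approximation. -/
theorem real_pow_three_le_of_isSetAlgebra {Y : Type*} [m : MeasurableSpace Y]
    {P Q : Measure Y} [IsFiniteMeasure P] [IsFiniteMeasure Q] {𝒜 : Set (Set Y)}
    (h𝒜 : IsSetAlgebra 𝒜) (hgen : m = MeasurableSpace.generateFrom 𝒜) {c : ℝ}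
    (h : ∀ D ∈ 𝒜, P.real D ^ 3 ≤ c * Q.real D ^ 2) {D : Set Y} (hD : MeasurableSet D) :
    P.real D ^ 3 ≤ c * Q.real D ^ 2 := by
  have hdense := Measure.MeasureDense.of_generateFrom_isSetAlgebra_finite (P + Q) h𝒜 hgen
  have hε : ∀ n : ℕ, (0 : ℝ) < 1 / ((n : ℝ) + 1) := fun n => Nat.one_div_pos_of_nat
  choose t ht htD using fun n : ℕ => hdense.approx D hD (measure_ne_top _ _) _ (hε n)
  have htm : ∀ n, MeasurableSet (t n) := fun n => hdense.measurable _ (ht n)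
  have hlim : ∀ R : Measure Y, IsFiniteMeasure R → R ≤ P + Q →
      Tendsto (fun n => R.real (t n)) atTop (𝓝 (R.real D)) := by
    intro R _ hR
    rw [tendsto_iff_dist_tendsto_zero]
    refine squeeze_zero (fun n => dist_nonneg) (fun n => ?_) tendsto_one_div_add_atTop_nhds_zero_nat
    rw [dist_comm, Real.dist_eq]
    refine (abs_measureReal_sub_le_measureReal_symmDiff hD.nullMeasurableSet
      (htm n).nullMeasurableSet).trans ?_
    exact ENNReal.toReal_le_of_le_ofReal (hε n).le ((hR _).trans (htD n).le)
  refine le_of_tendsto_of_tendsto' ((hlim P inferInstance (Measure.le_add_right le_rfl)).pow 3)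
    (((hlim Q inferInstance (Measure.le_add_left le_rfl)).pow 2).const_mul c) fun n => h _ (ht n)

theorem IsPoissonLaw.real_pow_three_le {X : Type*} [MeasurableSpace X]
    {P Q : Measure (Configuration X)} {μ μ' : Measure X} (hP : IsPoissonLaw P μ)
    (hQ : IsPoissonLaw Q μ') {g : X → ℝ≥0∞} (hg : Measurable g) (hμ : μ = μ'.withDensity g)
    {B : ℕ → Set X} (hB : ∀ n, MeasurableSet (B n)) (hmono : Monotone B)
    (hU : ⋃ n, B n = Set.univ) (hfin : ∀ n, μ (B n) ≠ ∞) (hfin' : ∀ n, μ' (B n) ≠ ∞)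
    (hg3 : ∀ n, ∫⁻ x in B n, g x ^ 3 ∂μ' ≠ ∞) {c : ℝ}
    (hc : Tendsto (fun n => Real.exp (2 * μ'.real (B n) - 3 * μ.real (B n) +
      (∫⁻ x in B n, g x ^ 3 ∂μ').toReal)) atTop (𝓝 c))
    {D : Set (Configuration X)} (hD : MeasurableSet D) :
    P.real D ^ 3 ≤ c * Q.real D ^ 2 := by
  have := hP.isProbabilityMeasure
  have := hQ.isProbabilityMeasure
  refine real_pow_three_le_of_isSetAlgebra (isSetAlgebra_localSets hB hmono)
    (generateFrom_localSets hB hmono hU) (fun D hD => ?_) hD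
  -- A fixed local event depends on `B n` only, for every large `n`. So it satisfies the
  -- finite-volume inequality with the `n`-th constant, and `n` may tend to infinity.
  refine ge_of_tendsto (hc.mul_const _) ?_
  filter_upwards [eventually_exists_eq_restrict_preimage hmono hD] with n hn
  obtain ⟨D', hD', rfl⟩ := hn
  have : IsFiniteMeasure (μ.restrict (B n)) := ⟨by simpa using (hfin n).lt_top⟩
  have : IsFiniteMeasure (μ'.restrict (B n)) := ⟨by simpa using (hfin' n).lt_top⟩
  have h := finitePoisson_pow_three_le (μ.restrict (B n)) (μ'.restrict (B n)) hg
    (by rw [hμ, restrict_withDensity (hB n)]) (hg3 n) hD'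
  rw [← hP.map_restrict_eq (hB n), ← hQ.map_restrict_eq (hB n),
    Measure.map_apply (Configuration.measurable_restrict (hB n)) hD',
    Measure.map_apply (Configuration.measurable_restrict (hB n)) hD'] at h
  have h' := ENNReal.toReal_mono (ENNReal.mul_ne_top ENNReal.ofReal_ne_top
    (ENNReal.pow_ne_top (measure_ne_top _ _))) h
  rw [ENNReal.toReal_pow, ENNReal.toReal_mul, ENNReal.toReal_pow,
    ENNReal.toReal_ofReal (Real.exp_pos _).le] at h'
  simpa only [measureReal_restrict_apply_univ, ← measureReal_def] using h'

/-! ### Comparison of the Poisson law with its image under a suspension -/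

theorem Aut.measurable_rep_symm {X : Type*} [MeasurableSpace X] {μ : Measure X} (T : Aut μ) :
    Measurable T.rep.symm :=
  (Quotient.out T : nonsingularPerm μ).2.2.measurable

/-- The representative of an element of `Aut(X, μ)` as a measurable equivalence. -/
def Aut.measurableEquiv {X : Type*} [MeasurableSpace X] {μ : Measure X} (T : Aut μ) : X ≃ᵐ X where
  toEquiv := T.rep
  measurable_toFun := T.measurable_rep
  measurable_invFun := T.measurable_rep_symm

theorem Aut.quasiMeasurePreserving_rep {X : Type*} [MeasurableSpace X] {μ : Measure X}
    (T : Aut μ) : Measure.QuasiMeasurePreserving T.rep μ μ :=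
  (Quotient.out T : nonsingularPerm μ).2.1

theorem Aut.quasiMeasurePreserving_rep_symm {X : Type*} [MeasurableSpace X] {μ : Measure X}
    (T : Aut μ) : Measure.QuasiMeasurePreserving T.rep.symm μ μ :=
  (Quotient.out T : nonsingularPerm μ).2.2

theorem compAut_absolutelyContinuous {X : Type*} [MeasurableSpace X] {μ : Measure X}
    (T : Aut μ) : compAut μ T ≪ μ :=
  T.quasiMeasurePreserving_rep_symm.absolutelyContinuous

theorem absolutelyContinuous_compAut {X : Type*} [MeasurableSpace X] {μ : Measure X}
    (T : Aut μ) : μ ≪ compAut μ T := by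
  refine Measure.AbsolutelyContinuous.mk fun s hs h => ?_
  rw [compAut, Measure.map_apply T.measurable_rep_symm hs] at h
  have := T.quasiMeasurePreserving_rep.preimage_null h
  rwa [← Set.preimage_comp, Equiv.symm_comp_self, Set.preimage_id] at this

theorem real_pow_three_le_map_suspension {X : Type*} [MeasurableSpace X] (μ : Measure X)
    [SigmaFinite μ] (T : Aut μ) (hT : T ∈ Aut₁ μ) (hχ : χ μ T = 0)
    (hint : Integrable (fun x => (μ.rnDeriv (compAut μ T) x).toReal ^ 2 - 1) μ)
    {D : Set (Configuration X)} (hD : MeasurableSet D) :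
    (poisson μ).real D ^ 3 ≤
      Real.exp (∫ x, ((μ.rnDeriv (compAut μ T) x).toReal ^ 2 - 1) ∂μ) *
        ((poisson μ).map (Configuration.map T.rep.symm T.measurable_rep_symm)).real D ^ 2 := by
  have hσ : SigmaFinite (compAut μ T) := T.measurableEquiv.symm.sigmaFinite_map
  have hac := compAut_absolutelyContinuous T
  have hac' := absolutelyContinuous_compAut T
  set μ' := compAut μ T with hμ'
  set g := μ.rnDeriv μ' with hgdef
  have hg : Measurable g := Measure.measurable_rnDeriv _ _
  have hd : μ'.withDensity g = μ := Measure.withDensity_rnDeriv_eq _ _ hac'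
  have hB := measurableSet_spanningSets μ
  have hfin : ∀ n, μ (spanningSets μ n) ≠ ∞ := fun n => (measure_spanningSets_lt_top μ n).ne
  have hon : ∀ n, IntegrableOn (fun _ => (1 : ℝ)) (spanningSets μ n) μ := fun n =>
    integrableOn_const (hfin n)
  have hf1 : Integrable (fun x => (μ'.rnDeriv μ x).toReal - 1) μ := hT
  have hf : ∀ n, IntegrableOn (fun x => (μ'.rnDeriv μ x).toReal) (spanningSets μ n) μ := by
    intro n
    exact (hf1.integrableOn.add (hon n)).congr_fun (fun x _ => sub_add_cancel _ _) (hB n)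
  have hg2 : ∀ n, IntegrableOn (fun x => (g x).toReal ^ 2) (spanningSets μ n) μ := by
    intro n
    exact (hint.integrableOn.add (hon n)).congr_fun (fun x _ => sub_add_cancel _ _) (hB n)
  have hfin' : ∀ n, μ' (spanningSets μ n) ≠ ∞ := by
    intro n
    rw [← Measure.setLIntegral_rnDeriv hac, ← lintegral_congr_ae
      (ae_restrict_of_ae ((Measure.rnDeriv_lt_top μ' μ).mono fun x hx =>
        ENNReal.ofReal_toReal hx.ne))]
    exact (hf n).lintegral_lt_top.ne
  have hgtop : ∀ᵐ x ∂μ, g x ^ 2 < ∞ :=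
    hac'.ae_le ((Measure.rnDeriv_lt_top μ μ').mono fun x hx => ENNReal.pow_lt_top hx)
  have hcube : ∀ n, ∫⁻ x in spanningSets μ n, g x ^ 3 ∂μ' =
      ∫⁻ x in spanningSets μ n, g x ^ 2 ∂μ := by
    intro n
    -- One factor `g` is absorbed by `μ = g μ'`, which turns the third moment under `μ'` into a
    -- second moment under `μ`.
    have h := setLIntegral_withDensity_eq_setLIntegral_mul μ' hg (hg.pow_const 2) (hB n)
    rw [hd] at h
    rw [h]
    exact lintegral_congr fun x => pow_succ' (g x) 2
  have hreal : ∀ n, (∫⁻ x in spanningSets μ n, g x ^ 3 ∂μ').toReal =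
      ∫ x in spanningSets μ n, (g x).toReal ^ 2 ∂μ := by
    intro n
    rw [hcube, ← integral_toReal (hg.pow_const 2).aemeasurable (ae_restrict_of_ae hgtop)]
    simp_rw [ENNReal.toReal_pow]
  have hg3 : ∀ n, ∫⁻ x in spanningSets μ n, g x ^ 3 ∂μ' ≠ ∞ := by
    intro n
    rw [hcube, ← lintegral_congr_ae (ae_restrict_of_ae (hgtop.mono fun x hx =>
        ENNReal.ofReal_toReal hx.ne))]
    simp_rw [ENNReal.toReal_pow]
    exact (hg2 n).lintegral_lt_top.ne
  have hsub : ∀ n (h : X → ℝ), IntegrableOn h (spanningSets μ n) μ →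
      ∫ x in spanningSets μ n, (h x - 1) ∂μ =
        ∫ x in spanningSets μ n, h x ∂μ - μ.real (spanningSets μ n) := by
    intro n h hh
    rw [integral_sub hh (hon n)]
    simp
  have hlim : ∀ h : X → ℝ, Integrable h μ → Tendsto (fun n => ∫ x in spanningSets μ n, h x ∂μ)
      atTop (𝓝 (∫ x, h x ∂μ)) := by
    intro h hh
    have := tendsto_setIntegral_of_monotone hB (monotone_spanningSets μ) (f := h) (μ := μ)
      hh.integrableOn
    rwa [iUnion_spanningSets, setIntegral_univ] at this
  refine (isPoissonLaw_poisson μ).real_pow_three_le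
    ((isPoissonLaw_poisson μ).map T.measurable_rep_symm) hg hd.symm hB (monotone_spanningSets μ)
    (iUnion_spanningSets μ) hfin hfin' hg3 ?_ hD
  -- On a spanning set the exponent is `2 ∫ (dμ'/dμ - 1) dμ + ∫ (g² - 1) dμ`: the multiples of
  -- `μ(B)` combine as `-2 - 1 = -3`.
  have h1 := ((hlim _ hf1).const_mul 2).add (hlim _ hint)
  have hχ' : ∫ x, ((μ'.rnDeriv μ x).toReal - 1) ∂μ = 0 := hχ
  rw [hχ', mul_zero, zero_add] at h1
  refine (Real.continuous_exp.tendsto _).comp (h1.congr fun n => ?_)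
  rw [hsub n _ (hf n), hsub n _ (hg2 n), Measure.setIntegral_toReal_rnDeriv hac]
  change _ = 2 * μ'.real _ - 3 * μ.real _ +
    (∫⁻ x in spanningSets μ n, g x ^ 3 ∂μ').toReal
  rw [hreal]
  ring

theorem absolutelyContinuous_map_suspension {X : Type*} [MeasurableSpace X] (μ : Measure X)
    [SigmaFinite μ] (T : Aut μ) (hT : T ∈ Aut₁ μ) (hχ : χ μ T = 0)
    (hint : Integrable (fun x => (μ.rnDeriv (compAut μ T) x).toReal ^ 2 - 1) μ) :
    poisson μ ≪ (poisson μ).map (Configuration.map T.rep.symm T.measurable_rep_symm) := by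
  refine Measure.AbsolutelyContinuous.mk fun D hD h => ?_
  have h1 := real_pow_three_le_map_suspension μ T hT hχ hint hD
  rw [measureReal_def (μ := (poisson μ).map _), h] at h1
  have h2 : (poisson μ).real D ^ 3 = 0 :=
    le_antisymm (by simpa using h1) (pow_nonneg measureReal_nonneg 3)
  exact (measureReal_eq_zero_iff).1 (pow_eq_zero_iff (by norm_num) |>.1 h2)

/-! ### Representatives -/

theorem mk_eq_mk_iff {X : Type*} [MeasurableSpace X] {μ : Measure X} {S T : nonsingularPerm μ} :
    (QuotientGroup.mk S : Aut μ) = QuotientGroup.mk T ↔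
      ∀ᵐ x ∂μ, (S : Equiv.Perm X) x = (T : Equiv.Perm X) x := by
  rw [QuotientGroup.eq]
  change (∀ᵐ x ∂μ, (S : Equiv.Perm X).symm ((T : Equiv.Perm X) x) = x) ↔ _
  refine eventually_congr (Eventually.of_forall fun x => ?_)
  rw [Equiv.symm_apply_eq, eq_comm]

theorem Aut.rep_mk {X : Type*} [MeasurableSpace X] {μ : Measure X} (S : nonsingularPerm μ) :
    ∀ᵐ x ∂μ, Aut.rep (QuotientGroup.mk S : Aut μ) x = (S : Equiv.Perm X) x :=
  mk_eq_mk_iff.1 (Quotient.out_eq (QuotientGroup.mk S : Aut μ))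

theorem Aut.rep_mul {X : Type*} [MeasurableSpace X] {μ : Measure X} (S T : Aut μ) :
    ∀ᵐ x ∂μ, (S * T).rep x = S.rep (T.rep x) := by
  have h : S * T = (QuotientGroup.mk (Quotient.out S * Quotient.out T) : Aut μ) := by
    conv_lhs => rw [← Quotient.out_eq S, ← Quotient.out_eq T]
    rfl
  rw [h]
  exact Aut.rep_mk _

theorem Aut.rep_inv {X : Type*} [MeasurableSpace X] {μ : Measure X} (T : Aut μ) :
    ∀ᵐ x ∂μ, T⁻¹.rep x = T.rep.symm x := by
  have h : T⁻¹ = (QuotientGroup.mk (Quotient.out T)⁻¹ : Aut μ) := by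
    conv_lhs => rw [← Quotient.out_eq T]
    rfl
  rw [h]
  exact Aut.rep_mk _

theorem Aut.rep_one {X : Type*} [MeasurableSpace X] {μ : Measure X} :
    ∀ᵐ x ∂μ, (1 : Aut μ).rep x = x :=
  Aut.rep_mk (1 : nonsingularPerm μ)

theorem Aut.eq_one_of_ae {X : Type*} [MeasurableSpace X] {μ : Measure X} {T : Aut μ}
    (h : ∀ᵐ x ∂μ, T.rep x = x) : T = 1 := by
  rw [← Quotient.out_eq T]
  exact mk_eq_mk_iff.2 h

theorem Aut.rep_symm_inv {X : Type*} [MeasurableSpace X] {μ : Measure X} (T : Aut μ) :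
    ∀ᵐ x ∂μ, T⁻¹.rep.symm x = T.rep x := by
  filter_upwards [T.quasiMeasurePreserving_rep.ae T.rep_inv] with x hx
  rw [Equiv.symm_apply_eq, hx, Equiv.symm_apply_apply]

/-! ### A criterion for conservativity -/

/-- Let `C` be the set of points of `B` with at most `m` returns to `B`. Almost every orbit visits
`C` at most `m` times, so `∑ P(h⁻¹ C) ≤ m P(Y) < ∞`, which forces `P(C) = 0`. -/
theorem isConservative_of_tsum_eq_top {Y : Type*} [MeasurableSpace Y] {P : Measure Y}
    [IsFiniteMeasure P] (H : Subgroup (Aut P)) [Countable H]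
    (hH : ∀ C : Set Y, MeasurableSet C → P C ≠ 0 → ∑' h : H, P (h.1.rep ⁻¹' C) = ∞) :
    IsConservative H := by
  intro B hB _
  set N : Y → ℝ≥0∞ := fun y => ∑' h : H, B.indicator 1 (h.1.rep y) with hN
  have hNm : Measurable N := Measurable.tsum fun h =>
    (measurable_one.indicator hB).comp h.1.measurable_rep
  have hC : ∀ m : ℕ, P {y | y ∈ B ∧ N y ≤ m} = 0 := by
    intro m
    set C : Set Y := {y | y ∈ B ∧ N y ≤ m} with hCdef
    have hCm : MeasurableSet C := hB.inter (measurableSet_le hNm measurable_const)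
    by_contra hne
    refine (hH C hCm hne).not_lt ?_
    have h1 : ∑' h : H, P (h.1.rep ⁻¹' C) =
        ∫⁻ z, ∑' h : H, C.indicator 1 (h.1.rep z) ∂P := by
      have hm : ∀ h : H, AEMeasurable (fun z => C.indicator (1 : Y → ℝ≥0∞) (h.1.rep z)) P :=
        fun h => ((measurable_one.indicator hCm).comp h.1.measurable_rep).aemeasurable
      rw [lintegral_tsum hm]
      refine tsum_congr fun h => ?_
      rw [← lintegral_indicator_one (h.1.measurable_rep hCm)]
      rfl
    have h2 : ∀ᵐ z ∂P, ∑' h : H, C.indicator (1 : Y → ℝ≥0∞) (h.1.rep z) ≤ m := by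
      have hmul : ∀ᵐ z ∂P, ∀ h h₀ : H, (h.1 * h₀.1).rep z = h.1.rep (h₀.1.rep z) :=
        ae_all_iff.2 fun h => ae_all_iff.2 fun h₀ => Aut.rep_mul h.1 h₀.1
      filter_upwards [hmul] with z hz
      by_cases hex : ∃ h₀ : H, h₀.1.rep z ∈ C
      · obtain ⟨h₀, hh₀⟩ := hex
        -- The visits are counted from the point `h₀ z` of `C` instead of `z`; right translation by
        -- `h₀` permutes the group.
        refine le_trans ?_ hh₀.2
        rw [hN, ← (Equiv.mulRight h₀).tsum_eq]
        refine ENNReal.tsum_le_tsum fun h => ?_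
        have : ((Equiv.mulRight h₀ h : H) : Aut P).rep z = h.1.rep (h₀.1.rep z) := hz h h₀
        rw [this]
        exact Set.indicator_le_indicator_of_subset (fun y hy => hy.1) (fun _ => zero_le) _
      · push Not at hex
        rw [ENNReal.tsum_eq_zero.2 fun h => Set.indicator_of_notMem (hex h) _]
        exact zero_le
    rw [h1]
    refine (lintegral_mono_ae h2).trans_lt ?_
    rw [lintegral_const]
    exact ENNReal.mul_lt_top (ENNReal.natCast_lt_top m) (measure_lt_top P _)
  have hae : ∀ᵐ y ∂P, ∀ m : ℕ, ¬(y ∈ B ∧ N y ≤ m) :=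
    ae_all_iff.2 fun m => by simpa [ae_iff] using hC m
  filter_upwards [hae] with y hy hyB hfin
  have hfin' : {h : H | h.1.rep y ∈ B}.Finite :=
    Set.Finite.of_finite_image (f := Subtype.val) (hfin.subset (by
      rintro _ ⟨h, hh, rfl⟩
      exact ⟨h.2, hh⟩)) Subtype.val_injective.injOn
  have hNy : N y = ({h : H | h.1.rep y ∈ B}.encard : ℝ≥0∞) := by
    rw [← ENNReal.tsum_set_one, tsum_subtype {h : H | h.1.rep y ∈ B} fun _ => (1 : ℝ≥0∞)]
    rfl
  refine hy hfin'.toFinset.card ⟨hyB, ?_⟩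
  rw [hNy, hfin'.encard_eq_coe_toFinset_card]
  simp

/-! ### Suspensions -/

theorem Configuration.map_map {X : Type*} [MeasurableSpace X] {S T : X → X} (hS : Measurable S)
    (hT : Measurable T) (ω : Configuration X) :
    Configuration.map S hS (Configuration.map T hT ω) =
      Configuration.map (S ∘ T) (hS.comp hT) ω :=
  Subtype.ext (Measure.map_map hS hT)

theorem Configuration.map_id {X : Type*} [MeasurableSpace X] (ω : Configuration X) :
    Configuration.map id measurable_id ω = ω :=
  Subtype.ext Measure.map_id

/-- Almost surely no point of the configuration lies in the null set where `S` and `T` differ. Thus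
the choice of representatives does not affect the suspension. -/
theorem IsPoissonLaw.ae_map_congr {X : Type*} [MeasurableSpace X]
    {P : Measure (Configuration X)} {μ : Measure X} (hP : IsPoissonLaw P μ) {S T : X → X}
    (hS : Measurable S) (hT : Measurable T) (hST : ∀ᵐ x ∂μ, S x = T x) :
    ∀ᵐ ω ∂P, Configuration.map S hS ω = Configuration.map T hT ω := by
  filter_upwards [hP.ae_apply_eq_zero hST] with ω hω
  exact Subtype.ext (Measure.map_congr hω)

/-- The permutation `ω ↦ ω ∘ T⁻¹` of the space of configurations. -/
def suspensionPerm {X : Type*} [MeasurableSpace X] {μ : Measure X} (T : Aut μ) :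
    Equiv.Perm (Configuration X) where
  toFun := Configuration.map T.rep T.measurable_rep
  invFun := Configuration.map T.rep.symm T.measurable_rep_symm
  left_inv ω := by
    rw [Configuration.map_map]
    simp_rw [Equiv.symm_comp_self]
    exact Configuration.map_id ω
  right_inv ω := by
    rw [Configuration.map_map]
    simp_rw [Equiv.self_comp_symm]
    exact Configuration.map_id ω

theorem measurable_suspensionPerm {X : Type*} [MeasurableSpace X] {μ : Measure X} (T : Aut μ) :
    Measurable (suspensionPerm T) :=
  Configuration.measurable_map _ T.measurable_rep

theorem measurable_suspensionPerm_symm {X : Type*} [MeasurableSpace X] {μ : Measure X}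
    (T : Aut μ) : Measurable (suspensionPerm T).symm :=
  Configuration.measurable_map _ T.measurable_rep_symm

theorem suspensionPerm_symm_inv_ae {X : Type*} [MeasurableSpace X] {μ : Measure X} [SFinite μ]
    (T : Aut μ) : (suspensionPerm T⁻¹).symm =ᵐ[poisson μ] suspensionPerm T :=
  (isPoissonLaw_poisson μ).ae_map_congr T⁻¹.measurable_rep_symm T.measurable_rep T.rep_symm_inv

/-- Pushing the two hypotheses forward, by the suspension and by its inverse, moves the image
measure to the left of `≪`. The second one applies because the inverse of the suspension of `T⁻¹` is
almost everywhere that of `T`. -/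
theorem suspensionPerm_mem_nonsingularPerm {X : Type*} [MeasurableSpace X] {μ : Measure X}
    [SFinite μ] (T : Aut μ)
    (hT : poisson μ ≪ (poisson μ).map (suspensionPerm T).symm)
    (hT' : poisson μ ≪ (poisson μ).map (suspensionPerm T⁻¹).symm) :
    suspensionPerm T ∈ nonsingularPerm (poisson μ) := by
  refine ⟨⟨measurable_suspensionPerm T, ?_⟩, ⟨measurable_suspensionPerm_symm T, ?_⟩⟩
  · have h := hT.map (measurable_suspensionPerm T)
    rwa [Measure.map_map (measurable_suspensionPerm T) (measurable_suspensionPerm_symm T),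
      Equiv.self_comp_symm, Measure.map_id] at h
  · rw [Measure.map_congr (suspensionPerm_symm_inv_ae T)] at hT'
    have h := hT'.map (measurable_suspensionPerm_symm T)
    rwa [Measure.map_map (measurable_suspensionPerm_symm T) (measurable_suspensionPerm T),
      Equiv.symm_comp_self, Measure.map_id] at h

/-- The homomorphism `γ ↦ γ_*`. -/
def suspensionHom {X : Type*} [MeasurableSpace X] {μ : Measure X} [SFinite μ]
    (Γ : Subgroup (Aut μ))
    (hΓ : ∀ γ ∈ Γ, poisson μ ≪ (poisson μ).map (suspensionPerm γ).symm) :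
    Γ →* Aut (poisson μ) :=
  MonoidHom.mk' (fun γ => QuotientGroup.mk ⟨suspensionPerm γ.1,
    suspensionPerm_mem_nonsingularPerm γ.1 (hΓ _ γ.2) (hΓ _ (Γ.inv_mem γ.2))⟩) (by
      intro γ δ
      rw [← QuotientGroup.mk_mul, mk_eq_mk_iff]
      filter_upwards [(isPoissonLaw_poisson μ).ae_map_congr (γ.1 * δ.1).measurable_rep
        (γ.1.measurable_rep.comp δ.1.measurable_rep) (Aut.rep_mul γ.1 δ.1)] with ω hω
      exact hω.trans
        (Configuration.map_map γ.1.measurable_rep δ.1.measurable_rep ω).symm)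

theorem suspensionHom_rep {X : Type*} [MeasurableSpace X] {μ : Measure X} [SFinite μ]
    (Γ : Subgroup (Aut μ))
    (hΓ : ∀ γ ∈ Γ, poisson μ ≪ (poisson μ).map (suspensionPerm γ).symm) (γ : Γ) :
    IsSuspension γ.1 (suspensionHom Γ hΓ γ) :=
  Aut.rep_mk _

/-- A nontrivial transformation moves a set of positive finite measure off itself. -/
theorem exists_disjoint_preimage {X : Type*} [MeasurableSpace X] [StandardBorelSpace X]
    {μ : Measure X} [SigmaFinite μ] {T : X → X} (hT : Measurable T)
    (hne : ¬ ∀ᵐ x ∂μ, T x = x) :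
    ∃ A, MeasurableSet A ∧ μ A ≠ 0 ∧ μ A ≠ ∞ ∧ Disjoint A (T ⁻¹' A) := by
  by_contra! hcon
  apply hne
  have hnull : ∀ A, MeasurableSet A → Disjoint A (T ⁻¹' A) → μ A = 0 := by
    intro A hA hdisj
    rw [← Set.inter_univ A, ← iUnion_spanningSets μ, Set.inter_iUnion]
    refine measure_iUnion_null fun n => by_contra fun h0 => ?_
    exact hcon (A ∩ spanningSets μ n) (hA.inter (measurableSet_spanningSets μ n)) h0
      ((measure_mono Set.inter_subset_right).trans_lt (measure_spanningSets_lt_top μ n)).ne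
      (hdisj.mono Set.inter_subset_left (Set.preimage_mono Set.inter_subset_left))
  -- If `T x ≠ x`, some `S n` contains exactly one of `x` and `T x`. The points separated in either
  -- way by `S n` form a set disjoint from its preimage.
  obtain ⟨S, hS, hsep⟩ := exists_seq_separating X (p := MeasurableSet) MeasurableSet.empty
    Set.univ
  have h1 : ∀ n, μ (S n ∩ T ⁻¹' (S n)ᶜ) = 0 := fun n =>
    hnull _ ((hS n).inter (hT (hS n).compl)) (Set.disjoint_left.2 fun x hx hx' => hx.2 hx'.1)
  have h2 : ∀ n, μ ((S n)ᶜ ∩ T ⁻¹' (S n)) = 0 := fun n =>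
    hnull _ ((hS n).compl.inter (hT (hS n))) (Set.disjoint_left.2 fun x hx hx' => hx'.1 hx.2)
  have h1' : ∀ᵐ x ∂μ, ∀ n, x ∉ S n ∩ T ⁻¹' (S n)ᶜ :=
    ae_all_iff.2 fun n => measure_eq_zero_iff_ae_notMem.1 (h1 n)
  have h2' : ∀ᵐ x ∂μ, ∀ n, x ∉ (S n)ᶜ ∩ T ⁻¹' (S n) :=
    ae_all_iff.2 fun n => measure_eq_zero_iff_ae_notMem.1 (h2 n)
  filter_upwards [h1', h2'] with x hx1 hx2
  refine hsep _ trivial _ trivial fun n => ⟨fun h => ?_, fun h => ?_⟩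
  · by_contra hx
    exact hx2 n ⟨hx, h⟩
  · by_contra hx
    exact hx1 n ⟨h, hx⟩

/-- If `T ≠ 1`, take `A` of positive finite measure disjoint from `T⁻¹A`. A trivial suspension gives
`ω(A) = ω(T⁻¹A)` almost surely, so `A` and `A ∪ T⁻¹A` have equal void probabilities. Then `μ(T⁻¹A) =
0`, against nonsingularity. -/
theorem eq_one_of_isSuspension_one {X : Type*} [MeasurableSpace X] [StandardBorelSpace X]
    {μ : Measure X} [SigmaFinite μ] {T : Aut μ} (hT : IsSuspension T (1 : Aut (poisson μ))) :
    T = 1 := by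
  refine Aut.eq_one_of_ae (by_contra fun hne => ?_)
  obtain ⟨A, hA, h0, htop, hdisj⟩ := exists_disjoint_preimage T.measurable_rep hne
  have hTA := T.measurable_rep hA
  have hP := isPoissonLaw_poisson μ
  have hae : ({ω | ω.1 A = 0} : Set (Configuration X)) =ᵐ[poisson μ]
      {ω | ω.1 (A ∪ T.rep ⁻¹' A) = 0} := by
    filter_upwards [hT, Aut.rep_one (μ := poisson μ)] with ω h1 h2
    have h3 : ω.1 A = ω.1 (T.rep ⁻¹' A) := by
      conv_lhs => rw [← h2, h1]
      exact Measure.map_apply T.measurable_rep hA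
    refine propext ?_
    change ω.1 A = 0 ↔ ω.1 (A ∪ T.rep ⁻¹' A) = 0
    rw [measure_union_null_iff, ← h3, and_self]
  have h := measure_congr hae
  rw [hP.measure_apply_eq_zero hA, hP.measure_apply_eq_zero (hA.union hTA),
    measure_union hdisj hTA] at h
  have h4 : μ (T.rep ⁻¹' A) = 0 := by
    have := expNeg_strictAnti.injective h
    exact (ENNReal.add_right_inj htop).1 (by rw [add_zero, ← this])
  apply h0
  have h5 := T.quasiMeasurePreserving_rep_symm.preimage_null h4
  rwa [← Set.preimage_comp, Equiv.self_comp_symm, Set.preimage_id] at h5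

theorem suspensionHom_injective {X : Type*} [MeasurableSpace X] [StandardBorelSpace X]
    {μ : Measure X} [SigmaFinite μ] (Γ : Subgroup (Aut μ))
    (hΓ : ∀ γ ∈ Γ, poisson μ ≪ (poisson μ).map (suspensionPerm γ).symm) :
    Function.Injective (suspensionHom Γ hΓ) := by
  refine (injective_iff_map_eq_one _).2 fun γ hγ => Subtype.ext ?_
  have h := suspensionHom_rep Γ hΓ γ
  rw [hγ] at h
  exact eq_one_of_isSuspension_one h

/-! ### Divergence -/

theorem tsum_measure_eq_top_of_pow_three_le {Y ι : Type*} [MeasurableSpace Y] {P : Measure Y}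
    [IsFiniteMeasure P] {Q : ι → Measure Y} [∀ i, IsFiniteMeasure (Q i)] {b e : ι → ℝ}
    (hb : ∀ i, 0 < b i) (hbsum : ¬ Summable b) (hbe : Summable fun i => b i ^ 2 * e i)
    {D : Set Y} (hD : P D ≠ 0) (h : ∀ i, P.real D ^ 3 ≤ e i * (Q i).real D ^ 2) :
    ∑' i, Q i D = ∞ := by
  by_contra hne
  have hQ : Summable fun i => (Q i).real D := ENNReal.summable_toReal hne
  have hpos : 0 < P.real D := ENNReal.toReal_pos hD (measure_ne_top _ _)
  have hev : ∀ᶠ i in cofinite, b i ^ 2 * e i ≤ 1 :=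
    hbe.tendsto_cofinite_zero.eventually_le_const one_pos
  -- Here `P(D) √P(D) = P(D)^{3/2}`. If `∑ Q_i(D)` converged, then `b_i ≤ P(D)^{-3/2} Q_i(D)` for
  -- almost all `i` would make `b` summable.
  refine hbsum ((hQ.mul_left (P.real D * √(P.real D))⁻¹).of_norm_bounded_eventually ?_)
  filter_upwards [hev] with i hi
  have hs : √(P.real D) ^ 2 = P.real D := Real.sq_sqrt hpos.le
  rw [Real.norm_of_nonneg (hb i).le, inv_mul_eq_div, le_div_iff₀ (by positivity)]
  refine le_of_sq_le_sq ?_ measureReal_nonneg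
  calc (b i * (P.real D * √(P.real D))) ^ 2 = b i ^ 2 * P.real D ^ 3 := by
        rw [mul_pow, mul_pow, hs]; ring
    _ ≤ b i ^ 2 * (e i * (Q i).real D ^ 2) := by gcongr; exact h i
    _ = b i ^ 2 * e i * (Q i).real D ^ 2 := by ring
    _ ≤ 1 * (Q i).real D ^ 2 := by gcongr
    _ = (Q i).real D ^ 2 := one_mul _

theorem isConservative_range_suspensionHom {X : Type*} [MeasurableSpace X]
    [StandardBorelSpace X] {μ : Measure X} [SigmaFinite μ] (Γ : Subgroup (Aut μ)) [Countable Γ]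
    (hΓ : ∀ γ ∈ Γ, poisson μ ≪ (poisson μ).map (suspensionPerm γ).symm)
    (hsum : ∀ D : Set (Configuration X), MeasurableSet D → poisson μ D ≠ 0 →
      ∑' γ : Γ, (poisson μ).map (suspensionPerm γ.1).symm D = ∞) :
    IsConservative (suspensionHom Γ hΓ).range := by
  have hcount : Countable (suspensionHom Γ hΓ).range :=
    (suspensionHom Γ hΓ).rangeRestrict_surjective.countable
  refine isConservative_of_tsum_eq_top _ fun D hD hD0 => ?_
  -- The criterion involves `P(γ_*⁻¹ D)`, while the divergent series has the terms `P(γ_* D)`;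
  -- inversion in `Γ` exchanges them. Injectivity ensures that each element of the range is counted
  -- once.
  rw [← hsum D hD hD0,
    ← (MonoidHom.ofInjective (suspensionHom_injective Γ hΓ)).toEquiv.tsum_eq,
    ← (Equiv.inv Γ).tsum_eq fun γ : Γ => (poisson μ).map (suspensionPerm γ.1).symm D]
  refine tsum_congr fun γ => ?_
  rw [Measure.map_apply (measurable_suspensionPerm_symm _) hD]
  have h1 : (suspensionPerm γ⁻¹.1).symm =ᵐ[poisson μ] suspensionPerm γ.1 :=
    suspensionPerm_symm_inv_ae γ.1
  have h2 : (suspensionHom Γ hΓ γ).rep =ᵐ[poisson μ] suspensionPerm γ.1 :=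
    suspensionHom_rep Γ hΓ γ
  exact measure_congr ((h2.trans h1.symm).preimage D)

end PoissonSuspension

end

/-- The existential asserts that the suspensions `γ_*` are elements of `Aut(X*, μ*)` and that
`γ ↦ γ_*` is a homomorphism; the group `Γ_*` is its range. -/
theorem lemma1p3 {X : Type*} [MeasurableSpace X] [StandardBorelSpace X]
    (μ : Measure X) [SigmaFinite μ] [NullSingletonClass μ]
    (Γ : Subgroup (Aut μ)) [Countable Γ]
    (hΓ : ∀ γ ∈ Γ, γ ∈ Aut₁ μ)
    (hχ : ∀ γ ∈ Γ, χ μ γ = 0)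
    (hint : ∀ γ ∈ Γ, Integrable (fun x => (μ.rnDeriv (compAut μ γ) x).toReal ^ 2 - 1) μ)
    (b : Γ → ℝ) (hb : ∀ γ, 0 < b γ) (hbsum : ¬ Summable b)
    (hbexp : Summable fun γ : Γ =>
      b γ ^ 2 * Real.exp (∫ x, ((μ.rnDeriv (compAut μ (γ : Aut μ)) x).toReal ^ 2 - 1) ∂μ)) :
    ∃ φ : Γ →* Aut (poisson μ),
      (∀ γ : Γ, IsSuspension (γ : Aut μ) (φ γ)) ∧ IsConservative φ.range := by
  have hac : ∀ γ ∈ Γ, poisson μ ≪ (poisson μ).map (suspensionPerm γ).symm := fun γ hγ =>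
    absolutelyContinuous_map_suspension μ γ (hΓ γ hγ) (hχ γ hγ) (hint γ hγ)
  refine ⟨suspensionHom Γ hac, suspensionHom_rep Γ hac,
    isConservative_range_suspensionHom Γ hac fun D hD hD0 => ?_⟩
  exact tsum_measure_eq_top_of_pow_three_le hb hbsum hbexp hD0 fun γ =>
    real_pow_three_le_map_suspension μ γ.1 (hΓ _ γ.2) (hχ _ γ.2) (hint _ γ.2) hD
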